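/- Let $L,k\ge 1$, let $d=d_0,d_1,\dots,d_L$ be layer widths with $d_L=1$, and let $(G_i,X_i,y_i)$, $i=1,\dots,k$, be training data, where $G_i$ is a finite undirected simple graph on $n_i$ vertices with adjacency matrix $A(G_i)$, $X_i\in\mathbb{R}^{d\times n_i}$ is a matrix of node features and $y_i\in\{-1,+1\}$. Put $A'(G_i)=A(G_i)+I_{n_i}$. The linear MPNN with weights $W=(W^{(1)},\dots,W^{(L)})$, $W^{(j)}\in\mathbb{R}^{d_j\times d_{j-1}}$, computes $X_i^{(0)}=X_i$, $X_i^{(j+1)}=W^{(j+1)}X_i^{(j)}A'(G_i)$ and the prediction $\hat y_i=X_i^{(L)}\mathbf 1_{n_i}\in\mathbb{R}$. For the exponential loss $\ell(x)=e^{-x}$ let $\mathcal R(W)=\frac1k\sum_{i=1}^k\ell(y_i\hat y_i)$ be the empirical risk. Let $v_i=y_iX_iA'(G_i)^L\mathbf 1_{n_i}\in\mathbb{R}^d$. Assume that the data are separable, i.e. there is $u\in\mathbb{R}^d$ with $\langle u,v_i\rangle>0$ for all $i$, let $$\gamma=\max_{\|u\|=1}\min_{1\le i\le k}\langle u,v_i\rangle>0,$$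 and let $\bar u$ be the maximum-margin direction, i.e. a unit vector that attains this maximum. Assume that the support vectors, i.e. those $v_i$ with $\langle\bar u,v_i\rangle=\gamma$, span $\mathbb{R}^d$. Let $W(t)$, $t\ge 0$, be a gradient flow trajectory of the risk, $\frac{dW(t)}{dt}=-\nabla\mathcal R(W(t))$, whose initialization satisfies $\nabla\mathcal R(W(0))\ne 0$ and $\mathcal R(W(0))\le \mathcal R(0)=\ell(0)$. Then $$\lim_{t\to\infty}\frac{W^{(L)}(t)W^{(L-1)}(t)\cdots W^{(1)}(t)}{\|W^{(L)}(t)\|_F\,\|W^{(L-1)}(t)\|_F\cdots\|W^{(1)}(t)\|_F}=\bar u^{\mathsf T},$$ where $\|\cdot\|_F$ is the Frobenius norm. -/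

import Mathlib

open Filter Topology

noncomputable section

/-- A training example `(G, X, y)` with `d`-dimensional node features: an undirected simple graph
on `n` vertices, a `d × n` feature matrix whose columns belong to the vertices, and a label in
`{-1, +1}`. -/
structure TrainingExample (d : ℕ) where
  n : ℕ
  G : SimpleGraph (Fin n)
  X : Matrix (Fin d) (Fin n) ℝ
  y : ℝ
  y_mem : y = 1 ∨ y = -1

open Classical in
/-- The matrix `A'(G) = A(G) + I`. -/
def adjPlusId {n : ℕ} (G : SimpleGraph (Fin n)) : Matrix (Fin n) (Fin n) ℝ :=
  G.adjMatrix ℝ + 1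

/-- The space of all weights `(W^(1), …, W^(L))` of an `L`-layer network with layer widths
`dims 0, …, dims L`: the Euclidean space of all entries of all the weight matrices.
The layer with index `j : Fin L` holds `W^(j+1)`, of size `dims (j+1) × dims j`. -/
abbrev Weights (L : ℕ) (dims : ℕ → ℕ) : Type :=
  EuclideanSpace ℝ (Σ j : Fin L, Fin (dims (j + 1)) × Fin (dims j))

section Network

variable {L : ℕ} {dims : ℕ → ℕ}

/-- The weight matrix `W^(j+1)`. -/
def layer (W : Weights L dims) (j : Fin L) : Matrix (Fin (dims (j + 1))) (Fin (dims j)) ℝ :=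
  Matrix.of fun a b => W ⟨j, (a, b)⟩

/-- The partial product `W^(j) ⋯ W^(1)`. -/
def partialProd (W : Weights L dims) : (j : ℕ) → j ≤ L → Matrix (Fin (dims j)) (Fin (dims 0)) ℝ
  | 0, _ => 1
  | j + 1, h => layer W ⟨j, h⟩ * partialProd W j (Nat.le_of_succ_le h)

/-- The product of all weights, `W^(L) ⋯ W^(1)`. -/
def weightProd (W : Weights L dims) : Matrix (Fin (dims L)) (Fin (dims 0)) ℝ :=
  partialProd W L le_rfl

/-- The node embeddings of the linear message-passing network: `X^(0) = X` and
`X^(j+1) = W^(j+1) X^(j) A'(G)`. -/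
def nodeEmbedding (W : Weights L dims) (e : TrainingExample (dims 0)) :
    (j : ℕ) → j ≤ L → Matrix (Fin (dims j)) (Fin e.n) ℝ
  | 0, _ => e.X
  | j + 1, h => layer W ⟨j, h⟩ * nodeEmbedding W e j (Nat.le_of_succ_le h) * adjPlusId e.G

/-- The scalar prediction `X^(L) 1_n`, for output width `dims L = 1`. -/
def prediction (hout : dims L = 1) (W : Weights L dims) (e : TrainingExample (dims 0)) : ℝ :=
  (nodeEmbedding W e L le_rfl).mulVec (fun _ => 1) (Fin.cast hout.symm 0)

/-- The empirical risk `(1/k) ∑ ℓ(y_i ŷ_i)`. -/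
def empiricalRisk (ℓ : ℝ → ℝ) (hout : dims L = 1) {k : ℕ}
    (D : Fin k → TrainingExample (dims 0)) (W : Weights L dims) : ℝ :=
  (1 / (k : ℝ)) * ∑ i, ℓ ((D i).y * prediction hout W (D i))

end Network

/-- The exponential loss. -/
def expLoss (x : ℝ) : ℝ := Real.exp (-x)

/-- `W : [0, ∞) → E` is a gradient flow trajectory of `R`: `dW/dt = -∇R(W(t))` for all `t ≥ 0`
(one-sided derivative at `0`). -/
def IsGradientFlow {E : Type*} [NormedAddCommGroup E] [InnerProductSpace ℝ E] [CompleteSpace E]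
    (R : E → ℝ) (W : ℝ → E) : Prop :=
  ∀ t : ℝ, 0 ≤ t → HasDerivWithinAt W (-gradient R (W t)) (Set.Ici 0) t

section Frobenius

attribute [local instance] Matrix.frobeniusNormedAddCommGroup

/-- The Frobenius norm of a real matrix. -/
def frobeniusNorm {m n : ℕ} (A : Matrix (Fin m) (Fin n) ℝ) : ℝ := ‖A‖

end Frobenius

section Margin

variable {d k : ℕ}

/-- The vector `y X A'(G)^L 1_n`. -/
def dataVector (L : ℕ) (e : TrainingExample d) : EuclideanSpace ℝ (Fin d) :=
  WithLp.toLp 2 (e.y • (e.X * adjPlusId e.G ^ L).mulVec (fun _ => 1))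

/-- The margin `min_i y_i uᵀ X_i A'(G_i)^L 1` of a direction `u` on a nonempty training set. -/
def margin (L : ℕ) (D : Fin k → TrainingExample d) (u : EuclideanSpace ℝ (Fin d)) : ℝ :=
  ⨅ i, inner ℝ u (dataVector L (D i))

/-- `u` is a unit vector that maximizes the margin among all unit vectors. -/
def IsMaxMarginDirection (L : ℕ) (D : Fin k → TrainingExample d)
    (u : EuclideanSpace ℝ (Fin d)) : Prop :=
  u ∈ Metric.sphere (0 : EuclideanSpace ℝ (Fin d)) 1 ∧
    IsMaxOn (margin L D) (Metric.sphere (0 : EuclideanSpace ℝ (Fin d)) 1) u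

/-- The support vectors: those data vectors whose inner product with `u` is the margin of `u`. -/
def supportVectors (L : ℕ) (D : Fin k → TrainingExample d)
    (u : EuclideanSpace ℝ (Fin d)) : Set (EuclideanSpace ℝ (Fin d)) :=
  {v | ∃ i, v = dataVector L (D i) ∧ inner ℝ u (dataVector L (D i)) = margin L D u}

end Margin

end

/-! Label times prediction equals ⟨w, v_i⟩ with wᵀ = W^(L)⋯W^(1), so the flow is that of a deep
linear network with exponential loss on the vectors v_i. Let R be the risk, q the `linearForce` at
w, p the row W^(L)⋯W^(2), and s = ⟨w, ū⟩. The first layer obeys dW^(1)/dt = pᵀqᵀ.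

Risk (`tendsto_risk_zero`): -R' ≥ ‖p‖²‖q‖² and ‖q‖ ≥ γR. The initial strict decrease brings R below
1 for good, which keeps w away from 0, while ‖w‖ ≤ ‖p‖‖W^(1)‖. Since ‖W^(1)‖² has derivative 2⟨w, q⟩
≤ 2, it grows at most linearly. Hence R' ≤ -κR²/(C+2t), and the divergence of ∫dt/(C+2t) gives R →
0. First-order optimality of ū (`exists_inner_le_margin_mul`) then forces s → ∞.

Norms (`tendsto_norm_predictor_div`): W^(j+1)ᵀW^(j+1) - W^(j)W^(j)ᵀ is conserved (`balance_eq`)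
while all layer norms diverge, so the normalized layers align. As the output width is one, ‖w‖ is
asymptotic to ∏‖W^(j)‖.

Direction (`tendsto_norm_perpRows_div`): ‖W^(1)ū‖² grows at rate 2s⟨ū, q⟩ ≥ 2sγR, the squared part
of W^(1) orthogonal to ū at rate at most 2e^{-γs} ≤ 2kR. Since s → ∞, the orthogonal part is
negligible, hence so is that of w relative to ∏‖W^(j)‖. -/

/-! ### Exponential risk of a linear predictor on separable vectors. -/

section Margin

variable {E : Type*} [NormedAddCommGroup E] [InnerProductSpace ℝ E] {k : ℕ}

/-- The exponential risk of the linear predictor `w` on the vectors `V i`. -/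
noncomputable def linearRisk (V : Fin k → E) (w : E) : ℝ :=
  (1 / (k : ℝ)) * ∑ i, Real.exp (-inner ℝ w (V i))

/-- The negative gradient of `linearRisk V` at `w`. -/
noncomputable def linearForce (V : Fin k → E) (w : E) : E :=
  (1 / (k : ℝ)) • ∑ i, Real.exp (-inner ℝ w (V i)) • V i

variable {V : Fin k → E} {u : E} {γ : ℝ}

lemma inner_linearForce (V : Fin k → E) (w x : E) :
    inner ℝ x (linearForce V w) =
      (1 / (k : ℝ)) * ∑ i, Real.exp (-inner ℝ w (V i)) * inner ℝ x (V i) := by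
  simp [linearForce, inner_smul_right, inner_sum]

lemma average_le {f : Fin k → ℝ} {c : ℝ} (hc : 0 ≤ c) (hf : ∀ i, f i ≤ c) :
    (1 / (k : ℝ)) * ∑ i, f i ≤ c := by
  rcases Nat.eq_zero_or_pos k with rfl | hk
  · simpa using hc
  · have hk' : (0 : ℝ) < k := by exact_mod_cast hk
    have h : ∑ i, f i ≤ k * c := by
      simpa using Finset.sum_le_sum (s := Finset.univ) fun i _ => hf i
    rw [one_div, inv_mul_le_iff₀ hk']
    exact h

lemma linearRisk_pos (hk : 1 ≤ k) (w : E) : 0 < linearRisk V w := by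
  have hk' : (0 : ℝ) < k := by exact_mod_cast hk
  have : Nonempty (Fin k) := ⟨⟨0, hk⟩⟩
  unfold linearRisk
  have := Finset.sum_pos (s := Finset.univ) (f := fun i : Fin k => Real.exp (-inner ℝ w (V i)))
    (fun i _ => Real.exp_pos _) Finset.univ_nonempty
  positivity

lemma margin_mul_linearRisk_le (hu : ∀ i, γ ≤ inner ℝ u (V i)) (w : E) :
    γ * linearRisk V w ≤ inner ℝ u (linearForce V w) := by
  rw [inner_linearForce, linearRisk, mul_left_comm, Finset.mul_sum]
  refine mul_le_mul_of_nonneg_left (Finset.sum_le_sum fun i _ => ?_) (by positivity)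
  rw [mul_comm γ]
  exact mul_le_mul_of_nonneg_left (hu i) (Real.exp_pos _).le

lemma exp_neg_mul_self_le_one (x : ℝ) : Real.exp (-x) * x ≤ 1 := by
  have h := Real.add_one_le_exp x
  have h2 : Real.exp (-x) * Real.exp x = 1 := by rw [← Real.exp_add]; simp
  nlinarith [Real.exp_pos (-x)]

/-- Caps the growth of the squared norm of the first layer at a linear rate, independently of w. -/
lemma inner_self_linearForce_le (w : E) : inner ℝ w (linearForce V w) ≤ 1 := by
  rw [inner_linearForce]
  exact average_le zero_le_one fun i => exp_neg_mul_self_le_one _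

/-- Split ⟪w, V i⟫ into the contribution of u, at least γ⟪w, u⟫, and that of the orthogonal part, b.
The factor e^{-b} absorbs b, so the bound does not depend on the size of the orthogonal part. -/
lemma inner_perp_linearForce_le (hu : ∀ i, γ ≤ inner ℝ u (V i)) {w : E}
    (hw : 0 ≤ inner ℝ w u) :
    inner ℝ (w - inner ℝ w u • u) (linearForce V w) ≤ Real.exp (-(γ * inner ℝ w u)) := by
  rw [inner_linearForce]
  refine average_le (Real.exp_pos _).le fun i => ?_
  set s := inner ℝ w u
  set b := inner ℝ (w - s • u) (V i) with hb
  have hz : inner ℝ w (V i) = s * inner ℝ u (V i) + b := by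
    rw [hb, inner_sub_left, inner_smul_left]
    simp
  rw [hz, neg_add, Real.exp_add, mul_assoc]
  have h1 : Real.exp (-(s * inner ℝ u (V i))) ≤ Real.exp (-(γ * s)) :=
    Real.exp_le_exp.2 (by nlinarith [hu i])
  have h2 := exp_neg_mul_self_le_one b
  calc _ ≤ Real.exp (-(s * inner ℝ u (V i))) * 1 :=
        mul_le_mul_of_nonneg_left h2 (Real.exp_pos _).le
    _ ≤ _ := by simpa using h1

lemma exists_inner_le_mul_norm (hk : 1 ≤ k) (hmax : ∀ x : E, ‖x‖ = 1 → ∃ i, inner ℝ x (V i) ≤ γ)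
    (x : E) : ∃ i, inner ℝ x (V i) ≤ γ * ‖x‖ := by
  by_cases hx : x = 0
  · exact ⟨⟨0, hk⟩, by simp [hx]⟩
  · have hn : 0 < ‖x‖ := norm_pos_iff.2 hx
    obtain ⟨i, hi⟩ := hmax (‖x‖⁻¹ • x) (by rw [norm_smul]; simp [hn.ne'])
    refine ⟨i, ?_⟩
    rw [inner_smul_left] at hi
    simp only [map_inv₀, conj_trivial] at hi
    rwa [inv_mul_le_iff₀ hn, mul_comm] at hi

/-- First-order optimality of the maximum-margin direction `u`: the margin of any vector `w` is
at most `γ ⟪w, u⟫`. -/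
lemma exists_inner_le_margin_mul (hk : 1 ≤ k) (hγ : 0 < γ) (hnorm : ‖u‖ = 1)
    (hu : ∀ i, γ ≤ inner ℝ u (V i)) (hmax : ∀ x : E, ‖x‖ = 1 → ∃ i, inner ℝ x (V i) ≤ γ)
    (w : E) : ∃ i, inner ℝ w (V i) ≤ γ * inner ℝ w u := by
  have : Nonempty (Fin k) := ⟨⟨0, hk⟩⟩
  obtain ⟨i, hi⟩ := Finite.exists_min fun i => inner ℝ w (V i)
  refine ⟨i, ?_⟩
  by_contra! hlt
  set s := inner ℝ w u
  set m := inner ℝ w (V i)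
  set c := γ * (1 - 2 * s + ‖w‖ ^ 2) / 2 with hc
  -- Moving from u towards w by ε raises the margin to first order by ε(m - γ), but the norm only by
  -- ε(s - 1). Maximality of γ leaves m - γs = O(ε).
  have key : ∀ ε : ℝ, 0 < ε → ε < 1 → m - γ * s ≤ ε * c := by
    intro ε h0 h1
    obtain ⟨j, hj⟩ := exists_inner_le_mul_norm hk hmax ((1 - ε) • u + ε • w)
    rw [inner_add_left, inner_smul_left, inner_smul_left] at hj
    simp only [conj_trivial] at hj
    have hsq : ‖(1 - ε) • u + ε • w‖ ^ 2
        = (1 - ε) ^ 2 + 2 * ε * (1 - ε) * s + ε ^ 2 * ‖w‖ ^ 2 := by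
      rw [norm_add_sq_real, norm_smul, norm_smul, inner_smul_left, inner_smul_right,
        real_inner_comm, mul_pow, mul_pow, hnorm]
      simp only [Real.norm_eq_abs, sq_abs, conj_trivial]
      ring
    set N := ‖(1 - ε) • u + ε • w‖
    -- This is tangent at N = 1, so it replaces the norm by its square at no first-order cost.
    have hN : N ≤ (1 + N ^ 2) / 2 := by nlinarith [sq_nonneg (N - 1)]
    have h2 : (1 - ε) * γ + ε * m ≤ γ * ((1 + N ^ 2) / 2) :=
      calc (1 - ε) * γ + ε * m ≤ (1 - ε) * inner ℝ u (V j) + ε * inner ℝ w (V j) :=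
            add_le_add (mul_le_mul_of_nonneg_left (hu j) (by linarith))
              (mul_le_mul_of_nonneg_left (hi j) h0.le)
        _ ≤ γ * N := hj
        _ ≤ _ := mul_le_mul_of_nonneg_left hN hγ.le
    rw [hsq] at h2
    have h3 : ε * (m - γ * s) ≤ ε * (ε * c) := by rw [hc]; linarith
    exact le_of_mul_le_mul_left h3 h0
  set δ := m - γ * s
  have hδ : 0 < δ := sub_pos.2 hlt
  have hc0 : 0 ≤ |c| := abs_nonneg c
  -- Small enough that ε * c < δ, against `key`.
  set ε := min (1 / 2) (δ / (2 * (|c| + 1)))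
  have hε0 : 0 < ε := lt_min (by norm_num) (by positivity)
  have h1 := key ε hε0 (lt_of_le_of_lt (min_le_left _ _) (by norm_num))
  have h2 : ε * (2 * (|c| + 1)) ≤ δ :=
    (le_div_iff₀ (by positivity)).1 (min_le_right _ _)
  nlinarith [le_abs_self c]

/-- The least-margin summand alone suffices. Used twice: a vanishing risk forces ⟪w, u⟫ → ∞, and the
bound of `inner_perp_linearForce_le` becomes a multiple of the risk. -/
lemma exp_neg_margin_le_linearRisk (hk : 1 ≤ k) (hγ : 0 < γ) (hnorm : ‖u‖ = 1)
    (hu : ∀ i, γ ≤ inner ℝ u (V i)) (hmax : ∀ x : E, ‖x‖ = 1 → ∃ i, inner ℝ x (V i) ≤ γ)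
    (w : E) : Real.exp (-(γ * inner ℝ w u)) ≤ k * linearRisk V w := by
  obtain ⟨i, hi⟩ := exists_inner_le_margin_mul hk hγ hnorm hu hmax w
  have hk' : (k : ℝ) ≠ 0 := by positivity
  rw [linearRisk, ← mul_assoc, mul_one_div_cancel hk', one_mul]
  exact (Real.exp_le_exp.2 (neg_le_neg hi)).trans
    (Finset.single_le_sum (f := fun i => Real.exp (-inner ℝ w (V i)))
      (fun j _ => (Real.exp_pos _).le) (Finset.mem_univ i))

/-- From e^x ≥ 1 + x. A risk bounded below 1 thus keeps w away from 0. -/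
lemma one_sub_le_linearRisk (hk : 1 ≤ k) (w : E) :
    1 - ‖w‖ * ∑ i, ‖V i‖ ≤ linearRisk V w := by
  have hk' : (0 : ℝ) < k := by exact_mod_cast hk
  have h : (k : ℝ) * (1 - ‖w‖ * ∑ i, ‖V i‖) ≤ ∑ i, Real.exp (-inner ℝ w (V i)) := by
    have := Finset.sum_le_sum (s := Finset.univ) (f := fun _ : Fin k => 1 - ‖w‖ * ∑ i, ‖V i‖)
      (g := fun i => Real.exp (-inner ℝ w (V i))) fun i _ => by
        have h1 := Real.add_one_le_exp (-inner ℝ w (V i))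
        have h2 := real_inner_le_norm w (V i)
        have h3 : ‖V i‖ ≤ ∑ i, ‖V i‖ :=
          Finset.single_le_sum (f := fun i => ‖V i‖) (fun j _ => norm_nonneg _) (Finset.mem_univ i)
        have h4 := mul_le_mul_of_nonneg_left h3 (norm_nonneg w)
        linarith
    simpa only [Finset.sum_const, Finset.card_univ, Fintype.card_fin, nsmul_eq_mul] using this
  rw [linearRisk, one_div, le_inv_mul_iff₀ hk']
  exact h

end Margin

lemma hasDerivAt_toLp {n : ℕ} {f : ℝ → Fin n → ℝ} {f' : Fin n → ℝ} {t : ℝ}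
    (h : ∀ i, HasDerivAt (fun s => f s i) (f' i) t) :
    HasDerivAt (fun s => (WithLp.toLp 2 (f s) : EuclideanSpace ℝ (Fin n))) (WithLp.toLp 2 f') t := by
  rw [← hasDerivWithinAt_univ, hasDerivWithinAt_iff_hasFDerivWithinAt, hasFDerivWithinAt_euclidean]
  intro i
  have := (h i).hasDerivWithinAt (s := Set.univ)
  rw [hasDerivWithinAt_iff_hasFDerivWithinAt] at this
  exact this.congr_fderiv (by ext; simp)

/-! ### Matrix products, their derivatives and their gauge invariance. -/

section Chain

variable {dims : ℕ → ℕ}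

/-- A sequence of matrices of composable sizes. -/
abbrev LayerSeq (dims : ℕ → ℕ) : Type :=
  ∀ j : ℕ, Matrix (Fin (dims (j + 1))) (Fin (dims j)) ℝ

/-- The product `M (m-1) * ⋯ * M 0`. -/
def chain (M : LayerSeq dims) : ∀ m : ℕ, Matrix (Fin (dims m)) (Fin (dims 0)) ℝ
  | 0 => 1
  | m + 1 => M m * chain M m

/-- The product `M m * ⋯ * M 1`. -/
def tailChain (M : LayerSeq dims) : ∀ m : ℕ, Matrix (Fin (dims (m + 1))) (Fin (dims 1)) ℝ
  | 0 => 1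
  | m + 1 => M (m + 1) * tailChain M m

/-- The derivative of `chain · m` at `M` in the direction `H`. -/
def chainTangent (M H : LayerSeq dims) : ∀ m : ℕ, Matrix (Fin (dims m)) (Fin (dims 0)) ℝ
  | 0 => 0
  | m + 1 => H m * chain M m + M m * chainTangent M H m

lemma chain_succ_eq_tailChain_mul (M : LayerSeq dims) (m : ℕ) :
    chain M (m + 1) = tailChain M m * M 0 := by
  induction m with
  | zero => simp [chain, tailChain]
  | succ m ih => rw [chain, ih, tailChain, Matrix.mul_assoc]

lemma chainTangent_congr {M H H' : LayerSeq dims} {m : ℕ} (h : ∀ j < m, H j = H' j) :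
    chainTangent M H m = chainTangent M H' m := by
  induction m with
  | zero => rfl
  | succ m ih =>
    rw [chainTangent, chainTangent, ih fun j hj => h j (by omega), h m (by omega)]

lemma chainTangent_single_of_le (M : LayerSeq dims) (j : ℕ)
    (B : Matrix (Fin (dims (j + 1))) (Fin (dims j)) ℝ) {m : ℕ} (hm : m ≤ j) :
    chainTangent M (Pi.single j B) m = 0 := by
  induction m with
  | zero => rfl
  | succ m ih =>
    rw [chainTangent, ih (by omega), Pi.single_eq_of_ne (by omega)]
    simp

lemma chainTangent_single_succ (M : LayerSeq dims) (j : ℕ)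
    (B : Matrix (Fin (dims (j + 1))) (Fin (dims j)) ℝ) :
    chainTangent M (Pi.single j B) (j + 1) = B * chain M j := by
  rw [chainTangent, chainTangent_single_of_le M j B le_rfl]
  simp

lemma chainTangent_single_zero (M : LayerSeq dims)
    (B : Matrix (Fin (dims (0 + 1))) (Fin (dims 0)) ℝ) (m : ℕ) :
    chainTangent M (Pi.single 0 B) (m + 1) = tailChain M m * B := by
  induction m with
  | zero => rw [chainTangent_single_succ]; simp [chain, tailChain]
  | succ m ih =>
    rw [chainTangent, ih, Pi.single_eq_of_ne (by omega), tailChain, Matrix.mul_assoc]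
    simp

/-- The product of the layers is invariant under `M (j+1) ↦ M (j+1) g`, `M j ↦ g⁻¹ M j`. -/
lemma chainTangent_gauge (M : LayerSeq dims) (j : ℕ)
    (A : Matrix (Fin (dims (j + 1))) (Fin (dims (j + 1))) ℝ) {m : ℕ} (hm : j + 2 ≤ m) :
    chainTangent M (Pi.single (j + 1) (M (j + 1) * A)) m
      = chainTangent M (Pi.single j (A * M j)) m := by
  induction m, hm using Nat.le_induction with
  | base =>
    rw [chainTangent_single_succ, chainTangent, chainTangent_single_succ,
      Pi.single_eq_of_ne (by omega), chain]
    simp [Matrix.mul_assoc]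
  | succ m hm ih =>
    rw [chainTangent, chainTangent, ih, Pi.single_eq_of_ne (by omega),
      Pi.single_eq_of_ne (by omega)]

lemma hasDerivAt_chain {M : ℝ → LayerSeq dims} {H : LayerSeq dims} {t : ℝ}
    (h : ∀ j a b, HasDerivAt (fun s => M s j a b) (H j a b) t) (m : ℕ) (a : Fin (dims m))
    (b : Fin (dims 0)) :
    HasDerivAt (fun s => chain (M s) m a b) (chainTangent (M t) H m a b) t := by
  induction m with
  | zero => exact hasDerivAt_const _ _
  | succ m ih =>
    simp only [chain, chainTangent, Matrix.add_apply, Matrix.mul_apply, ← Finset.sum_add_distrib]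
    exact HasDerivAt.fun_sum fun c _ => (h m a c).mul (ih c)

end Chain

/-! ### The network as a linear predictor, and the gradient of its risk. -/

section Weights

variable {L : ℕ} {dims : ℕ → ℕ}

/-- The layers of a network, extended by zero matrices. -/
noncomputable def layerSeq (W : Weights L dims) : LayerSeq dims :=
  fun j => if h : j < L then layer W ⟨j, h⟩ else 0

/-- The weights given by the first `L` matrices of a sequence. -/
noncomputable def ofLayerSeq (H : LayerSeq dims) : Weights L dims :=
  WithLp.toLp 2 fun x => H x.1 x.2.1 x.2.2

lemma layerSeq_of_lt (W : Weights L dims) {j : ℕ} (h : j < L) :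
    layerSeq W j = layer W ⟨j, h⟩ := dif_pos h

lemma layerSeq_ofLayerSeq (H : LayerSeq dims) {j : ℕ} (h : j < L) :
    layerSeq (ofLayerSeq H : Weights L dims) j = H j := by
  rw [layerSeq_of_lt _ h]; rfl

lemma partialProd_eq_chain (W : Weights L dims) (m : ℕ) (hm : m ≤ L) :
    partialProd W m hm = chain (layerSeq W) m := by
  induction m with
  | zero => rfl
  | succ m ih => rw [partialProd, ih, chain, layerSeq_of_lt]

lemma layerSeq_add_smul (W H : Weights L dims) (s : ℝ) (j : ℕ) (a b) :
    layerSeq (W + s • H) j a b = layerSeq W j a b + s * layerSeq H j a b := by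
  unfold layerSeq
  split_ifs <;> simp [layer]

lemma inner_ofLayerSeq_single (g : Weights L dims) {j : ℕ} (hj : j < L)
    (B : Matrix (Fin (dims (j + 1))) (Fin (dims j)) ℝ) :
    inner ℝ g (ofLayerSeq (Pi.single j B) : Weights L dims)
      = (Matrix.transpose (layerSeq g j) * B).trace := by
  rw [PiLp.inner_apply, Fintype.sum_sigma, Finset.sum_eq_single ⟨j, hj⟩]
  · rw [Fintype.sum_prod_type, Finset.sum_comm, Matrix.trace]
    simp only [Matrix.diag_apply, Matrix.mul_apply, Matrix.transpose_apply, layerSeq_of_lt _ hj]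
    simp [ofLayerSeq, layer, mul_comm]
  · intro i _ hi
    refine Finset.sum_eq_zero fun x _ => ?_
    have : (i : ℕ) ≠ j := fun h => hi (Fin.ext h)
    simp [ofLayerSeq, Pi.single_eq_of_ne this]
  · simp

/-- The end-to-end linear predictor of a network of output width one. -/
noncomputable def predictor (hout : dims L = 1) (W : Weights L dims) :
    EuclideanSpace ℝ (Fin (dims 0)) :=
  WithLp.toLp 2 (chain (layerSeq W) L (Fin.cast hout.symm 0))

/-- Weights act from the left and `adjPlusId` from the right, so the two kinds of factors separate.
-/
lemma nodeEmbedding_eq (W : Weights L dims) (e : TrainingExample (dims 0)) (m : ℕ) (hm : m ≤ L) :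
    nodeEmbedding W e m hm = chain (layerSeq W) m * e.X * adjPlusId e.G ^ m := by
  induction m with
  | zero => simp [nodeEmbedding, chain]
  | succ m ih =>
    rw [nodeEmbedding, ih, chain, layerSeq_of_lt _ hm, pow_succ]
    simp only [Matrix.mul_assoc]

lemma label_mul_prediction (hout : dims L = 1) (W : Weights L dims)
    (e : TrainingExample (dims 0)) :
    e.y * prediction hout W e = inner ℝ (predictor hout W) (dataVector L e) := by
  rw [prediction, nodeEmbedding_eq, Matrix.mul_assoc, ← Matrix.mulVec_mulVec, dataVector,
    predictor, EuclideanSpace.inner_eq_star_dotProduct]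
  simp [Matrix.mulVec, dotProduct_comm]

lemma empiricalRisk_eq (hout : dims L = 1) {k : ℕ} (D : Fin k → TrainingExample (dims 0))
    (W : Weights L dims) :
    empiricalRisk expLoss hout D W
      = linearRisk (fun i => dataVector L (D i)) (predictor hout W) := by
  simp only [empiricalRisk, linearRisk, expLoss, label_mul_prediction]

lemma differentiable_chain (m : ℕ) (a : Fin (dims m)) (b : Fin (dims 0)) :
    Differentiable ℝ fun W : Weights L dims => chain (layerSeq W) m a b := by
  induction m with
  | zero => exact differentiable_const _
  | succ m ih =>
    simp only [chain, Matrix.mul_apply]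
    refine Differentiable.fun_sum fun c _ => Differentiable.fun_mul ?_ (ih c)
    unfold layerSeq
    split_ifs with h
    · simp only [layer, Matrix.of_apply]
      fun_prop
    · exact differentiable_const _

lemma differentiable_empiricalRisk (hout : dims L = 1) {k : ℕ}
    (D : Fin k → TrainingExample (dims 0)) :
    Differentiable ℝ (empiricalRisk expLoss hout D) := by
  have h : Differentiable ℝ (predictor hout : Weights L dims → _) :=
    differentiable_euclidean.2 fun b => differentiable_chain L _ b
  have : empiricalRisk expLoss hout D
      = fun W => linearRisk (fun i => dataVector L (D i)) (predictor hout W) :=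
    funext fun W => empiricalRisk_eq hout D W
  rw [this]
  unfold linearRisk
  exact (Differentiable.fun_sum fun i _ => (h.inner ℝ (differentiable_const _)).fun_neg.exp).const_mul _

/-- The risk along the line W + sH is differentiated in two ways, through the gradient and through
the product rule. -/
lemma inner_gradient_empiricalRisk (hout : dims L = 1) {k : ℕ}
    (D : Fin k → TrainingExample (dims 0)) (W H : Weights L dims) :
    inner ℝ (gradient (empiricalRisk expLoss hout D) W) H
      = -inner ℝ (WithLp.toLp 2 (chainTangent (layerSeq W) (layerSeq H) L
          (Fin.cast hout.symm 0)) : EuclideanSpace ℝ (Fin (dims 0)))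
          (linearForce (fun i => dataVector L (D i)) (predictor hout W)) := by
  have hline : HasDerivAt (fun s : ℝ => W + s • H) H 0 := by
    simpa using ((hasDerivAt_id (0 : ℝ)).smul_const H).const_add W
  have h1 : HasDerivAt (fun s : ℝ => empiricalRisk expLoss hout D (W + s • H))
      (inner ℝ (gradient (empiricalRisk expLoss hout D) W) H) 0 := by
    have hF := (differentiable_empiricalRisk hout D W).hasGradientAt.hasFDerivAt
    have h0 : W = W + (0 : ℝ) • H := by simp
    rw [h0] at hF
    simpa [Function.comp_def] using hF.comp_hasDerivAt (0 : ℝ) hline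
  have hp : HasDerivAt (fun s : ℝ => predictor hout (W + s • H))
      (WithLp.toLp 2 (chainTangent (layerSeq W) (layerSeq H) L (Fin.cast hout.symm 0))) 0 := by
    refine hasDerivAt_toLp fun b => ?_
    have := hasDerivAt_chain (M := fun s : ℝ => layerSeq (W + s • H)) (H := layerSeq H) (t := 0)
      (fun j a b => by
        simp only [layerSeq_add_smul]
        simpa using (hasDerivAt_id (0 : ℝ)).mul_const (layerSeq H j a b))
      L (Fin.cast hout.symm 0) b
    simpa using this
  have h2 : HasDerivAt (fun s : ℝ => empiricalRisk expLoss hout D (W + s • H))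
      (-inner ℝ (WithLp.toLp 2 (chainTangent (layerSeq W) (layerSeq H) L
          (Fin.cast hout.symm 0)) : EuclideanSpace ℝ (Fin (dims 0)))
          (linearForce (fun i => dataVector L (D i)) (predictor hout W))) 0 := by
    simp only [empiricalRisk_eq, linearRisk, inner_linearForce]
    have := (HasDerivAt.fun_sum (u := Finset.univ) fun (i : Fin k) _ =>
      ((hp.inner ℝ (hasDerivAt_const (0 : ℝ) (dataVector L (D i)))).fun_neg.exp)).const_mul
        (1 / (k : ℝ))
    simpa [Finset.mul_sum] using this
  exact h1.unique h2

/-- Tested on single-entry matrices in the first layer. The result has rank one, which makes the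
evolution of the first layer explicit. -/
lemma gradient_first_layer (hout : dims (L + 1) = 1) {k : ℕ}
    (D : Fin k → TrainingExample (dims 0)) (W : Weights (L + 1) dims) (a : Fin (dims 1))
    (b : Fin (dims 0)) :
    layerSeq (gradient (empiricalRisk expLoss hout D) W) 0 a b
      = -(tailChain (layerSeq W) L (Fin.cast hout.symm 0) a
        * linearForce (fun i => dataVector (L + 1) (D i)) (predictor hout W) b) := by
  have h := inner_gradient_empiricalRisk hout D W (ofLayerSeq (Pi.single 0 (Matrix.single a b 1)))
  rw [inner_ofLayerSeq_single _ L.succ_pos, chainTangent_congr (fun j hj => layerSeq_ofLayerSeq _ hj),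
    chainTangent_single_zero, Matrix.trace_mul_single] at h
  simp only [MulOpposite.op_one, one_smul, Matrix.transpose_apply] at h
  rw [h, PiLp.inner_apply, Finset.sum_eq_single b]
  · simp [mul_comm]
  · intro c _ hc
    simp [Matrix.mul_single_apply_of_ne _ _ _ _ _ hc]
  · simp

/-- Infinitesimal Noether argument: by `chainTangent_gauge` the directions W^(j+2)A and AW^(j+1)
change the product equally, so the gradient pairs equally with both, for every A. -/
lemma gradient_balance (hout : dims L = 1) {k : ℕ}
    (D : Fin k → TrainingExample (dims 0)) (W : Weights L dims) {j : ℕ} (hj : j + 1 < L) :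
    Matrix.transpose (layerSeq (gradient (empiricalRisk expLoss hout D) W) (j + 1))
        * layerSeq W (j + 1)
      = layerSeq W j * Matrix.transpose (layerSeq (gradient (empiricalRisk expLoss hout D) W) j) := by
  set g := gradient (empiricalRisk expLoss hout D) W with hg
  rw [Matrix.ext_iff_trace_mul_right]
  intro A
  have h1 := inner_gradient_empiricalRisk hout D W
    (ofLayerSeq (Pi.single (j + 1) (layerSeq W (j + 1) * A)))
  have h2 := inner_gradient_empiricalRisk hout D W (ofLayerSeq (Pi.single j (A * layerSeq W j)))
  rw [← hg, inner_ofLayerSeq_single _ (by omega),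
    chainTangent_congr (fun j hj => layerSeq_ofLayerSeq _ hj)] at h1 h2
  rw [chainTangent_gauge _ _ _ (by omega), ← h2] at h1
  rw [Matrix.mul_assoc, h1, ← Matrix.mul_assoc, Matrix.trace_mul_comm, Matrix.mul_assoc]

end Weights

/-! ### Frobenius norms and products of nearly aligned layers. -/

section Frobenius

attribute [local instance] Matrix.frobeniusNormedAddCommGroup Matrix.frobeniusNormedSpace
  Matrix.frobeniusNormedRing

lemma frobenius_norm_sq {m n : ℕ} (A : Matrix (Fin m) (Fin n) ℝ) :
    ‖A‖ ^ 2 = ∑ a, ∑ b, A a b ^ 2 := by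
  rw [Matrix.frobenius_norm_def, ← Real.sqrt_eq_rpow, Real.sq_sqrt (by positivity)]
  simp

lemma trace_transpose_mul_self {m n : ℕ} (A : Matrix (Fin m) (Fin n) ℝ) :
    (Matrix.transpose A * A).trace = ‖A‖ ^ 2 := by
  rw [frobenius_norm_sq, Finset.sum_comm]
  simp [Matrix.trace, Matrix.mul_apply, sq]

lemma trace_mul_transpose_self {m n : ℕ} (A : Matrix (Fin m) (Fin n) ℝ) :
    (A * Matrix.transpose A).trace = ‖A‖ ^ 2 := by
  rw [Matrix.trace_mul_comm, trace_transpose_mul_self]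

lemma frobenius_norm_eq_norm_row {m n : ℕ} (hm : m = 1) (A : Matrix (Fin m) (Fin n) ℝ) :
    ‖A‖ = ‖(WithLp.toLp 2 (A (Fin.cast hm.symm 0)) : EuclideanSpace ℝ (Fin n))‖ := by
  subst hm
  rw [← sq_eq_sq₀ (norm_nonneg _) (norm_nonneg _), frobenius_norm_sq, EuclideanSpace.norm_sq_eq]
  simp

lemma norm_tailChain_mul_le {dims : ℕ → ℕ} (M : LayerSeq dims) {l : ℕ}
    (B : Matrix (Fin (dims 1)) (Fin l) ℝ) (m : ℕ) :
    ‖tailChain M m * B‖ ≤ (∏ j ∈ Finset.range m, ‖M (j + 1)‖) * ‖B‖ := by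
  induction m with
  | zero => simp [tailChain]
  | succ m ih =>
    rw [tailChain, Matrix.mul_assoc, Finset.prod_range_succ]
    refine (Matrix.frobenius_norm_mul _ _).trans ?_
    refine (mul_le_mul_of_nonneg_left ih (norm_nonneg _)).trans_eq (by ring)

lemma norm_chain_succ_le {dims : ℕ → ℕ} (M : LayerSeq dims) (m : ℕ) :
    ‖chain M (m + 1)‖ ≤ ∏ j ∈ Finset.range (m + 1), ‖M j‖ := by
  rw [chain_succ_eq_tailChain_mul, Finset.prod_range_succ']
  exact norm_tailChain_mul_le M _ m

/-- Powers are positive because the identity may have norm above 1, as it does for Frobenius norms.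
-/
lemma norm_pow_succ_sub_pow_succ_le {A : Type*} [NormedRing A] {x y : A} (hx : ‖x‖ ≤ 1)
    (hy : ‖y‖ ≤ 1) (m : ℕ) : ‖x ^ (m + 1) - y ^ (m + 1)‖ ≤ (m + 1) * ‖x - y‖ := by
  induction m with
  | zero => simp
  | succ m ih =>
    have hsplit : x ^ (m + 2) - y ^ (m + 2)
        = x ^ (m + 1) * (x - y) + (x ^ (m + 1) - y ^ (m + 1)) * y := by
      rw [pow_succ x (m + 1), pow_succ y (m + 1)]; noncomm_ring
    have hxm : ‖x ^ (m + 1)‖ ≤ 1 :=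
      (norm_pow_le' x m.succ_pos).trans (pow_le_one₀ (norm_nonneg _) hx)
    rw [hsplit]
    calc _ ≤ ‖x ^ (m + 1)‖ * ‖x - y‖ + ‖x ^ (m + 1) - y ^ (m + 1)‖ * ‖y‖ :=
          (norm_add_le _ _).trans (add_le_add (norm_mul_le _ _) (norm_mul_le _ _))
      _ ≤ 1 * ‖x - y‖ + ((m + 1) * ‖x - y‖) * 1 := by gcongr
      _ = _ := by push_cast; ring

lemma mul_pow_mul_eq_pow_succ {m n : ℕ} (A : Matrix (Fin m) (Fin n) ℝ)
    (B : Matrix (Fin n) (Fin m) ℝ) (k : ℕ) : A * (B * A) ^ k * B = (A * B) ^ (k + 1) := by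
  induction k with
  | zero => simp
  | succ k ih =>
    rw [pow_succ (A * B), ← ih, pow_succ]
    simp only [Matrix.mul_assoc]

lemma norm_mul_mul_transpose_le {m n : ℕ} {N : Matrix (Fin m) (Fin n) ℝ} (hN : ‖N‖ ≤ 1)
    (X : Matrix (Fin n) (Fin n) ℝ) : ‖N * X * Matrix.transpose N‖ ≤ ‖X‖ := by
  have h : ‖Matrix.transpose N‖ ≤ 1 := by rwa [Matrix.frobenius_norm_transpose]
  calc _ ≤ ‖N‖ * ‖X‖ * ‖Matrix.transpose N‖ :=
        (Matrix.frobenius_norm_mul _ _).trans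
          (mul_le_mul_of_nonneg_right (Matrix.frobenius_norm_mul _ _) (norm_nonneg _))
    _ ≤ 1 * ‖X‖ * 1 := by gcongr
    _ = _ := by ring

/-- Asymptotically aligned layers multiply as if each were a power of the last one. -/
lemma tendsto_chain_mul_transpose_sub_pow {dims : ℕ → ℕ} {ι : Type*} {l : Filter ι}
    {N : ι → LayerSeq dims} {n : ℕ} (hN : ∀ t j, ‖N t j‖ ≤ 1)
    (hal : ∀ j < n, Tendsto (fun t => ‖Matrix.transpose (N t (j + 1)) * N t (j + 1)
      - N t j * Matrix.transpose (N t j)‖) l (𝓝 0)) (m : ℕ) (hm : m ≤ n) :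
    Tendsto (fun t => ‖chain (N t) (m + 1) * Matrix.transpose (chain (N t) (m + 1))
      - (N t m * Matrix.transpose (N t m)) ^ (m + 1)‖) l (𝓝 0) := by
  induction m with
  | zero => simpa [chain] using tendsto_const_nhds
  | succ m ih =>
    have hlim := (ih (by omega)).add ((hal m (by omega)).const_mul ((m : ℝ) + 1))
    rw [mul_zero, add_zero] at hlim
    refine squeeze_zero (fun t => norm_nonneg _) (fun t => ?_) hlim
    set A := N t (m + 1)
    set B := N t m
    set P := chain (N t) (m + 1)
    have hA : ‖A‖ ≤ 1 := hN _ _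
    have hB : ‖B‖ ≤ 1 := hN _ _
    have hAt : ‖Matrix.transpose A‖ ≤ 1 := by rwa [Matrix.frobenius_norm_transpose]
    have hBt : ‖Matrix.transpose B‖ ≤ 1 := by rwa [Matrix.frobenius_norm_transpose]
    have hAA : ‖Matrix.transpose A * A‖ ≤ 1 :=
      (Matrix.frobenius_norm_mul _ _).trans (mul_le_one₀ hAt (norm_nonneg _) hA)
    have hBB : ‖B * Matrix.transpose B‖ ≤ 1 :=
      (Matrix.frobenius_norm_mul _ _).trans (mul_le_one₀ hB (norm_nonneg _) hBt)
    -- The first term is small by induction, the second by alignment of A and B; then A(AᵀA)^(m+1)Aᵀ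
    -- is the next power of AAᵀ.
    have hsplit : chain (N t) (m + 1 + 1) * Matrix.transpose (chain (N t) (m + 1 + 1))
        - (A * Matrix.transpose A) ^ (m + 1 + 1)
        = A * (P * Matrix.transpose P - (B * Matrix.transpose B) ^ (m + 1)) * Matrix.transpose A
          + A * ((B * Matrix.transpose B) ^ (m + 1) - (Matrix.transpose A * A) ^ (m + 1))
            * Matrix.transpose A := by
      rw [← mul_pow_mul_eq_pow_succ, chain, Matrix.transpose_mul]
      simp only [Matrix.mul_sub, Matrix.sub_mul, Matrix.mul_assoc, A, P]
      abel
    rw [hsplit]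
    refine (norm_add_le _ _).trans (add_le_add (norm_mul_mul_transpose_le hA _) ?_)
    refine (norm_mul_mul_transpose_le hA _).trans ?_
    rw [norm_sub_rev (Matrix.transpose A * A)]
    exact norm_pow_succ_sub_pow_succ_le hBB hAA m

lemma norm_normalized_le_one {m n : ℕ} (A : Matrix (Fin m) (Fin n) ℝ) : ‖‖A‖⁻¹ • A‖ ≤ 1 := by
  rw [norm_smul, norm_inv, norm_norm]
  exact inv_mul_le_one

lemma chain_normalized {dims : ℕ → ℕ} (M : LayerSeq dims) (m : ℕ) :
    chain (fun j => ‖M j‖⁻¹ • M j) m = (∏ j ∈ Finset.range m, ‖M j‖)⁻¹ • chain M m := by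
  induction m with
  | zero => simp [chain]
  | succ m ih =>
    rw [chain, ih, Finset.prod_range_succ, chain, Matrix.smul_mul, Matrix.mul_smul, smul_smul,
      mul_inv_rev]

/-- If consecutive layers are balanced up to an error `C`, then the normalized layers are aligned
up to an error of order `‖A‖⁻²`. -/
lemma norm_normalized_balance_le {m n l : ℕ} {A : Matrix (Fin m) (Fin n) ℝ}
    {B : Matrix (Fin n) (Fin l) ℝ} {C : Matrix (Fin n) (Fin n) ℝ} (hA : A ≠ 0) (hB : B ≠ 0)
    (hC : Matrix.transpose A * A - B * Matrix.transpose B = C) :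
    ‖Matrix.transpose (‖A‖⁻¹ • A) * (‖A‖⁻¹ • A)
      - (‖B‖⁻¹ • B) * Matrix.transpose (‖B‖⁻¹ • B)‖ ≤ (‖C‖ + |C.trace|) * (‖A‖ ^ 2)⁻¹ := by
  have ha : ‖A‖ ≠ 0 := norm_ne_zero_iff.2 hA
  have hb : ‖B‖ ≠ 0 := norm_ne_zero_iff.2 hB
  -- The trace of the balance controls the mismatch between the two normalizations.
  have htr : ‖A‖ ^ 2 - ‖B‖ ^ 2 = C.trace := by
    rw [← hC, Matrix.trace_sub, trace_transpose_mul_self, trace_mul_transpose_self]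
  have hAA : Matrix.transpose A * A = B * Matrix.transpose B + C := by rw [← hC]; abel
  have hid : Matrix.transpose (‖A‖⁻¹ • A) * (‖A‖⁻¹ • A)
      - (‖B‖⁻¹ • B) * Matrix.transpose (‖B‖⁻¹ • B)
      = (‖A‖ ^ 2)⁻¹ • C - (C.trace * (‖A‖ ^ 2)⁻¹ * (‖B‖ ^ 2)⁻¹) • (B * Matrix.transpose B) := by
    simp only [Matrix.transpose_smul, Matrix.smul_mul, Matrix.mul_smul, smul_smul]
    rw [hAA, ← htr]
    ext i j
    simp only [Matrix.sub_apply, Matrix.smul_apply, Matrix.add_apply, smul_eq_mul]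
    field_simp
    ring
  have hBB : ‖B * Matrix.transpose B‖ ≤ ‖B‖ ^ 2 := by
    refine (Matrix.frobenius_norm_mul _ _).trans_eq ?_
    rw [Matrix.frobenius_norm_transpose, sq]
  rw [hid]
  refine (norm_sub_le _ _).trans ?_
  rw [norm_smul, norm_smul, norm_mul, norm_mul, norm_inv, norm_inv, norm_pow, norm_pow,
    norm_norm, norm_norm, Real.norm_eq_abs, add_mul]
  refine add_le_add (mul_comm _ _).le ?_
  calc |C.trace| * (‖A‖ ^ 2)⁻¹ * (‖B‖ ^ 2)⁻¹ * ‖B * Matrix.transpose B‖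
      ≤ |C.trace| * (‖A‖ ^ 2)⁻¹ * (‖B‖ ^ 2)⁻¹ * ‖B‖ ^ 2 := by gcongr
    _ = _ := by field_simp

end Frobenius

/-! ### Comparison arguments for functions of time. -/

section Calculus

lemma HasDerivWithinAt.antitoneOn_Ici {f f' : ℝ → ℝ} {a : ℝ}
    (hf : ∀ t, a ≤ t → HasDerivWithinAt f (f' t) (Set.Ici a) t) (h : ∀ t, a ≤ t → f' t ≤ 0) :
    AntitoneOn f (Set.Ici a) :=
  antitoneOn_of_hasDerivWithinAt_nonpos (convex_Ici a)
    (fun t ht => (hf t ht).continuousWithinAt)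
    (fun t ht => (hf t (interior_subset ht)).mono interior_subset)
    fun t ht => h t (interior_subset ht)

/-- A positive quantity which decays at least as fast as `f' = -κ f² / (C + 2t)` tends to zero. -/
lemma tendsto_zero_of_deriv_le {f f' : ℝ → ℝ} {a C κ : ℝ} (ha : 0 ≤ a) (hC : 0 < C) (hκ : 0 < κ)
    (hpos : ∀ t, a ≤ t → 0 < f t)
    (hf : ∀ t, a ≤ t → HasDerivWithinAt f (f' t) (Set.Ici a) t)
    (h : ∀ t, a ≤ t → f' t ≤ -(κ * f t ^ 2 / (C + 2 * t))) :
    Tendsto f atTop (𝓝 0) := by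
  have hCt : ∀ t, a ≤ t → 0 < C + 2 * t := fun t ht => by linarith
  -- The inequality for f says (1/f)' ≥ κ/(C + 2t), so 1/f grows at least like (κ/2) log(C + 2t).
  have hanti : AntitoneOn (fun t => κ / 2 * Real.log (C + 2 * t) - (f t)⁻¹) (Set.Ici a) := by
    refine HasDerivWithinAt.antitoneOn_Ici
      (f' := fun t => κ / 2 * (2 / (C + 2 * t)) - -f' t / f t ^ 2) (fun t ht => ?_) fun t ht => ?_
    · have h1 : HasDerivWithinAt (fun t : ℝ => C + 2 * t) 2 (Set.Ici a) t := by
        simpa using (((hasDerivAt_id t).const_mul 2).const_add C).hasDerivWithinAt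
      exact ((h1.log (hCt t ht).ne').const_mul _).sub ((hf t ht).fun_inv (hpos t ht).ne')
    · have h1 : κ / (C + 2 * t) ≤ -f' t / f t ^ 2 := by
        rw [le_div_iff₀ (pow_pos (hpos t ht) 2)]
        have := h t ht
        rw [div_mul_eq_mul_div]
        linarith
      have h2 : κ / 2 * (2 / (C + 2 * t)) = κ / (C + 2 * t) := by
        have := (hCt t ht).ne'
        field_simp
      rw [h2]
      linarith
  have hlog : Tendsto (fun t : ℝ => Real.log (C + 2 * t)) atTop atTop :=
    Real.tendsto_log_atTop.comp
      (tendsto_atTop_add_const_left _ _ (tendsto_id.const_mul_atTop two_pos))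
  have hinv : Tendsto (fun t => (f t)⁻¹) atTop atTop := by
    have h1 := tendsto_atTop_add_const_right atTop
      (-(κ / 2 * Real.log (C + 2 * a) - (f a)⁻¹)) (hlog.const_mul_atTop (half_pos hκ))
    refine tendsto_atTop_mono' _ ?_ h1
    filter_upwards [eventually_ge_atTop a] with t ht
    have := hanti (Set.mem_Ici.2 le_rfl) (Set.mem_Ici.2 ht) ht
    simp only at this
    linarith
  simpa [Function.comp_def] using tendsto_inv_atTop_zero.comp hinv

/-- If `B` grows infinitely slower than `A` and `A + B` diverges, then `B` is negligible. -/
lemma tendsto_div_add_zero {A B A' B' : ℝ → ℝ} {a : ℝ}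
    (hA : ∀ t, a ≤ t → HasDerivWithinAt A (A' t) (Set.Ici a) t)
    (hB : ∀ t, a ≤ t → HasDerivWithinAt B (B' t) (Set.Ici a) t)
    (hB0 : ∀ t, 0 ≤ B t)
    (hAB : ∀ ε > 0, ∀ᶠ t in atTop, B' t ≤ ε * A' t)
    (hlim : Tendsto (fun t => A t + B t) atTop atTop) :
    Tendsto (fun t => B t / (A t + B t)) atTop (𝓝 0) := by
  rw [Metric.tendsto_nhds]
  intro ε hε
  obtain ⟨T, hT⟩ := eventually_atTop.1 (hAB (ε / 2) (half_pos hε))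
  set b := max a T
  have hanti : AntitoneOn (fun t => B t - ε / 2 * A t) (Set.Ici b) := by
    refine HasDerivWithinAt.antitoneOn_Ici (f' := fun t => B' t - ε / 2 * A' t)
      (fun t ht => ?_) fun t ht => ?_
    · have hat : a ≤ t := (le_max_left _ _).trans ht
      have hsub : Set.Ici b ⊆ Set.Ici a := Set.Ici_subset_Ici.2 (le_max_left _ _)
      exact ((hB t hat).mono hsub).sub (((hA t hat).mono hsub).const_mul _)
    · have := hT t ((le_max_right _ _).trans ht)
      linarith
  set c := B b - ε / 2 * A b
  -- Beyond 2|c|/ε, the integration constant c costs at most the remaining ε/2 share of A + B.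
  filter_upwards [eventually_ge_atTop b, hlim.eventually_gt_atTop (2 * |c| / ε),
    hlim.eventually_gt_atTop 0] with t ht h1 h2
  have h3 : B t - ε / 2 * A t ≤ c := hanti (Set.mem_Ici.2 le_rfl) (Set.mem_Ici.2 ht) ht
  rw [div_lt_iff₀ hε] at h1
  rw [Real.dist_eq, sub_zero, abs_of_nonneg (div_nonneg (hB0 t) h2.le), div_lt_iff₀ h2]
  nlinarith [le_abs_self c, hB0 t, mul_nonneg hε.le (hB0 t)]

end Calculus

/-! ### The margin as a minimum over the data. -/

section Margin

variable {d k L : ℕ} {D : Fin k → TrainingExample d} {u : EuclideanSpace ℝ (Fin d)}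

lemma margin_le_inner (i : Fin k) (x : EuclideanSpace ℝ (Fin d)) :
    margin L D x ≤ inner ℝ x (dataVector L (D i)) :=
  ciInf_le (Set.finite_range _).bddBelow i

lemma exists_inner_eq_margin (hk : 1 ≤ k) (x : EuclideanSpace ℝ (Fin d)) :
    ∃ i, inner ℝ x (dataVector L (D i)) = margin L D x := by
  have : Nonempty (Fin k) := ⟨⟨0, hk⟩⟩
  exact exists_eq_ciInf_of_finite

lemma IsMaxMarginDirection.exists_inner_le (hk : 1 ≤ k) (hu : IsMaxMarginDirection L D u)
    (x : EuclideanSpace ℝ (Fin d)) (hx : ‖x‖ = 1) :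
    ∃ i, inner ℝ x (dataVector L (D i)) ≤ margin L D u := by
  obtain ⟨i, hi⟩ := exists_inner_eq_margin (L := L) (D := D) hk x
  exact ⟨i, hi.trans_le (hu.2 (by simpa using hx))⟩

lemma IsMaxMarginDirection.margin_pos (hk : 1 ≤ k) (hu : IsMaxMarginDirection L D u)
    (hsep : ∃ x : EuclideanSpace ℝ (Fin d), ∀ i, 0 < inner ℝ x (dataVector L (D i))) :
    0 < margin L D u := by
  obtain ⟨x, hx⟩ := hsep
  have hx0 : x ≠ 0 := by
    rintro rfl
    simpa using hx ⟨0, hk⟩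
  have hn : 0 < ‖x‖ := norm_pos_iff.2 hx0
  obtain ⟨i, hi⟩ := hu.exists_inner_le hk (‖x‖⁻¹ • x) (by rw [norm_smul]; simp [hn.ne'])
  refine lt_of_lt_of_le ?_ hi
  rw [inner_smul_left]
  exact mul_pos (by simpa using hn) (hx i)

end Margin

/-! ### Evolution equations and conservation laws of the flow. -/

section Flow

attribute [local instance] Matrix.frobeniusNormedAddCommGroup Matrix.frobeniusNormedSpace
  Matrix.frobeniusNormedRing

variable {n k : ℕ} {dims : ℕ → ℕ} {hout : dims (n + 1) = 1} {D : Fin k → TrainingExample (dims 0)}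
  {W : ℝ → Weights (n + 1) dims}

/-- The row vector `W^(L) ⋯ W^(2)`. -/
noncomputable def tailRow (hout : dims (n + 1) = 1) (W : Weights (n + 1) dims) :
    EuclideanSpace ℝ (Fin (dims 1)) :=
  WithLp.toLp 2 (tailChain (layerSeq W) n (Fin.cast hout.symm 0))

lemma predictor_apply (hout : dims (n + 1) = 1) (W : Weights (n + 1) dims) (b : Fin (dims 0)) :
    predictor hout W b = ∑ a, tailRow hout W a * layerSeq W 0 a b := by
  simp [predictor, tailRow, chain_succ_eq_tailChain_mul, Matrix.mul_apply]

lemma norm_predictor (hout : dims (n + 1) = 1) (W : Weights (n + 1) dims) :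
    ‖predictor hout W‖ = ‖chain (layerSeq W) (n + 1)‖ :=
  (frobenius_norm_eq_norm_row hout _).symm

lemma norm_predictor_le (hout : dims (n + 1) = 1) (W : Weights (n + 1) dims) :
    ‖predictor hout W‖ ≤ ‖tailRow hout W‖ * ‖layerSeq W 0‖ := by
  rw [norm_predictor, chain_succ_eq_tailChain_mul, tailRow, ← frobenius_norm_eq_norm_row hout]
  exact Matrix.frobenius_norm_mul _ _

/-- Only the first layer's share of the gradient is kept; having rank one, its squared norm factors.
-/
lemma norm_tailRow_mul_norm_linearForce_le (hout : dims (n + 1) = 1)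
    (D : Fin k → TrainingExample (dims 0)) (W : Weights (n + 1) dims) :
    ‖tailRow hout W‖ ^ 2
        * ‖linearForce (fun i => dataVector (n + 1) (D i)) (predictor hout W)‖ ^ 2
      ≤ ‖gradient (empiricalRisk expLoss hout D) W‖ ^ 2 := by
  set g := gradient (empiricalRisk expLoss hout D) W with hg
  have h0 : 0 < n + 1 := n.succ_pos
  have h1 : ∑ a, ∑ b, layerSeq g 0 a b ^ 2 ≤ ‖g‖ ^ 2 := by
    rw [EuclideanSpace.norm_sq_eq, Fintype.sum_sigma]
    refine le_trans (le_of_eq ?_) (Finset.single_le_sum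
      (f := fun j : Fin (n + 1) => ∑ x : Fin (dims (j + 1)) × Fin (dims j), ‖g ⟨j, x⟩‖ ^ 2)
      (fun j _ => Finset.sum_nonneg fun x _ => sq_nonneg _) (Finset.mem_univ ⟨0, h0⟩))
    rw [Fintype.sum_prod_type]
    simp [layerSeq_of_lt _ h0, layer]
  refine le_trans (le_of_eq ?_) h1
  simp only [hg, gradient_first_layer, neg_sq, mul_pow]
  rw [EuclideanSpace.norm_sq_eq, EuclideanSpace.norm_sq_eq, Finset.sum_mul_sum]
  simp [tailRow]

lemma hasDerivWithinAt_layerSeq (hflow : IsGradientFlow (empiricalRisk expLoss hout D) W) {t : ℝ}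
    (ht : 0 ≤ t) (j : ℕ) (a b) :
    HasDerivWithinAt (fun s => layerSeq (W s) j a b)
      (-layerSeq (gradient (empiricalRisk expLoss hout D) (W t)) j a b) (Set.Ici 0) t := by
  by_cases hj : j < n + 1
  · simp only [layerSeq_of_lt _ hj]
    simpa [Function.comp_def, layer] using
      (EuclideanSpace.proj ⟨⟨j, hj⟩, (a, b)⟩ :
        Weights (n + 1) dims →L[ℝ] ℝ).hasFDerivAt.comp_hasDerivWithinAt t (hflow t ht)
  · simpa [layerSeq, hj] using hasDerivWithinAt_const t (Set.Ici (0 : ℝ)) (0 : ℝ)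

lemma hasDerivWithinAt_first_layer (hflow : IsGradientFlow (empiricalRisk expLoss hout D) W)
    {t : ℝ} (ht : 0 ≤ t) (a b) :
    HasDerivWithinAt (fun s => layerSeq (W s) 0 a b)
      (tailRow hout (W t) a
        * linearForce (fun i => dataVector (n + 1) (D i)) (predictor hout (W t)) b)
      (Set.Ici 0) t := by
  have := hasDerivWithinAt_layerSeq hflow ht 0 a b
  rwa [gradient_first_layer, neg_neg] at this

lemma hasDerivWithinAt_risk (hflow : IsGradientFlow (empiricalRisk expLoss hout D) W) {t : ℝ}
    (ht : 0 ≤ t) :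
    HasDerivWithinAt (fun s => empiricalRisk expLoss hout D (W s))
      (-‖gradient (empiricalRisk expLoss hout D) (W t)‖ ^ 2) (Set.Ici 0) t := by
  have := (differentiable_empiricalRisk hout D (W t)).hasGradientAt.hasFDerivAt.comp_hasDerivWithinAt
    t (hflow t ht)
  simpa only [Function.comp_def, InnerProductSpace.toDual_apply_apply, inner_neg_right,
    real_inner_self_eq_norm_sq] using this

lemma hasDerivWithinAt_norm_sq_first_layer
    (hflow : IsGradientFlow (empiricalRisk expLoss hout D) W) {t : ℝ} (ht : 0 ≤ t) :
    HasDerivWithinAt (fun s => ‖layerSeq (W s) 0‖ ^ 2)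
      (2 * inner ℝ (predictor hout (W t))
        (linearForce (fun i => dataVector (n + 1) (D i)) (predictor hout (W t)))) (Set.Ici 0) t := by
  simp only [frobenius_norm_sq]
  have := HasDerivWithinAt.fun_sum (u := Finset.univ) fun (a : Fin (dims (0 + 1))) _ =>
    HasDerivWithinAt.fun_sum (u := Finset.univ) fun (b : Fin (dims 0)) _ =>
      (hasDerivWithinAt_first_layer hflow ht a b).fun_pow 2
  refine this.congr_deriv ?_
  rw [Finset.sum_comm, PiLp.inner_apply, Finset.mul_sum]
  refine Finset.sum_congr rfl fun b _ => ?_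
  rw [predictor_apply]
  simp only [RCLike.inner_apply, conj_trivial, Finset.mul_sum]
  refine Finset.sum_congr rfl fun a _ => ?_
  norm_num
  ring

lemma hasDerivWithinAt_norm_sq_first_layer_mulVec
    (hflow : IsGradientFlow (empiricalRisk expLoss hout D) W) (u : EuclideanSpace ℝ (Fin (dims 0)))
    {t : ℝ} (ht : 0 ≤ t) :
    HasDerivWithinAt (fun s => ∑ a, (∑ b, layerSeq (W s) 0 a b * u b) ^ 2)
      (2 * inner ℝ (predictor hout (W t)) u * inner ℝ u
        (linearForce (fun i => dataVector (n + 1) (D i)) (predictor hout (W t)))) (Set.Ici 0) t := by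
  have := HasDerivWithinAt.fun_sum (u := Finset.univ) fun (a : Fin (dims (0 + 1))) _ =>
    (HasDerivWithinAt.fun_sum (u := Finset.univ) fun (b : Fin (dims 0)) _ =>
      (hasDerivWithinAt_first_layer hflow ht a b).mul_const (u b)).fun_pow 2
  refine this.congr_deriv ?_
  set q := linearForce (fun i => dataVector (n + 1) (D i)) (predictor hout (W t))
  have h1 : inner ℝ (predictor hout (W t)) u
      = ∑ a, tailRow hout (W t) a * ∑ b, layerSeq (W t) 0 a b * u b := by
    rw [PiLp.inner_apply]
    simp only [predictor_apply, RCLike.inner_apply, conj_trivial, Finset.mul_sum]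
    rw [Finset.sum_comm]
    exact Finset.sum_congr rfl fun a _ => Finset.sum_congr rfl fun b _ => by ring
  have h2 : ∀ a, ∑ b, tailRow hout (W t) a * q b * u b = tailRow hout (W t) a * inner ℝ u q := by
    intro a
    rw [PiLp.inner_apply, Finset.mul_sum]
    exact Finset.sum_congr rfl fun b _ => by simp [mul_assoc]
  simp only [h1, h2]
  rw [Finset.mul_sum, Finset.sum_mul]
  refine Finset.sum_congr rfl fun a _ => ?_
  norm_num
  ring

/-- Gradient flow conserves the balance of consecutive layers. -/
lemma balance_eq (hflow : IsGradientFlow (empiricalRisk expLoss hout D) W) {j : ℕ} (hj : j < n)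
    {t : ℝ} (ht : 0 ≤ t) :
    Matrix.transpose (layerSeq (W t) (j + 1)) * layerSeq (W t) (j + 1)
        - layerSeq (W t) j * Matrix.transpose (layerSeq (W t) j)
      = Matrix.transpose (layerSeq (W 0) (j + 1)) * layerSeq (W 0) (j + 1)
        - layerSeq (W 0) j * Matrix.transpose (layerSeq (W 0) j) := by
  ext a b
  simp only [Matrix.sub_apply, Matrix.mul_apply, Matrix.transpose_apply]
  have hderiv : ∀ x, 0 ≤ x → HasDerivWithinAt
      (fun s => ∑ c, layerSeq (W s) (j + 1) c a * layerSeq (W s) (j + 1) c b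
        - ∑ c, layerSeq (W s) j a c * layerSeq (W s) j b c) 0 (Set.Ici 0) x := by
    intro x hx
    have h := (HasDerivWithinAt.fun_sum (u := Finset.univ) fun (c : Fin (dims (j + 1 + 1))) _ =>
      (hasDerivWithinAt_layerSeq hflow hx (j + 1) c a).fun_mul
        (hasDerivWithinAt_layerSeq hflow hx (j + 1) c b)).sub
      (HasDerivWithinAt.fun_sum (u := Finset.univ) fun (c : Fin (dims j)) _ =>
      (hasDerivWithinAt_layerSeq hflow hx j a c).fun_mul
        (hasDerivWithinAt_layerSeq hflow hx j b c))
    refine h.congr_deriv ?_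
    -- Entry (a, b) and its transpose (b, a) cancel the two halves of the derivative.
    have hb := gradient_balance hout D (W x) (j := j) (by omega)
    have h1 := congrFun (congrFun hb a) b
    have h2 := congrFun (congrFun hb b) a
    simp only [Matrix.mul_apply, Matrix.transpose_apply] at h1 h2
    simp only [neg_mul, mul_neg, Finset.sum_add_distrib, Finset.sum_neg_distrib]
    simp only [mul_comm (layerSeq (W x) (j + 1) _ _), mul_comm _ (layerSeq (W x) j _ _), h1, h2]
    ring
  exact constant_of_has_deriv_right_zero (a := 0) (b := t)
    (fun x hx => ((hderiv x hx.1).continuousWithinAt).mono Set.Icc_subset_Ici_self)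
    (fun x hx => (hderiv x hx.1).mono (Set.Ici_subset_Ici.2 hx.1)) t ⟨ht, le_rfl⟩

end Flow

/-! ### Long-time behaviour of risk, norms and direction. -/

section Convergence

attribute [local instance] Matrix.frobeniusNormedAddCommGroup Matrix.frobeniusNormedSpace
  Matrix.frobeniusNormedRing

/-- The matrix whose rows are the components of the rows of `A` orthogonal to the unit vector
`u`. -/
def perpRows {m d : ℕ} (A : Matrix (Fin m) (Fin d) ℝ) (u : EuclideanSpace ℝ (Fin d)) :
    Matrix (Fin m) (Fin d) ℝ :=
  Matrix.of fun a b => A a b - (∑ c, A a c * u c) * u b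

lemma sum_sq_add_norm_perpRows_sq {m d : ℕ} (A : Matrix (Fin m) (Fin d) ℝ)
    {u : EuclideanSpace ℝ (Fin d)} (hu : ‖u‖ = 1) :
    ∑ a, (∑ b, A a b * u b) ^ 2 + ‖perpRows A u‖ ^ 2 = ‖A‖ ^ 2 := by
  have hu2 : ∑ b, u b ^ 2 = 1 := by
    have := EuclideanSpace.norm_sq_eq u
    simpa [hu] using this.symm
  rw [frobenius_norm_sq, frobenius_norm_sq, ← Finset.sum_add_distrib]
  refine Finset.sum_congr rfl fun a _ => ?_
  simp only [perpRows, Matrix.of_apply]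
  set c := ∑ b, A a b * u b with hc
  have h : ∑ b, (A a b - c * u b) ^ 2
      = ∑ b, A a b ^ 2 - 2 * c * ∑ b, A a b * u b + c ^ 2 * ∑ b, u b ^ 2 := by
    rw [Finset.mul_sum _ _ (2 * c), Finset.mul_sum _ _ (c ^ 2), ← Finset.sum_sub_distrib,
      ← Finset.sum_add_distrib]
    exact Finset.sum_congr rfl fun b _ => by ring
  rw [h, hu2, ← hc]
  ring

/-- If finitely many nonnegative functions differ by constants and their product diverges, then
each of them diverges. -/
lemma tendsto_atTop_of_prod {x : ℕ → ℝ → ℝ} {c : ℕ → ℝ} {m : ℕ}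
    (h0 : ∀ j t, 0 ≤ x j t) (hc : ∀ j < m, ∀ t, 0 ≤ t → x j t = x 0 t + c j)
    (hprod : Tendsto (fun t => ∏ j ∈ Finset.range m, x j t) atTop atTop) :
    Tendsto (x 0) atTop atTop := by
  rw [tendsto_atTop]
  intro K
  set S := ∑ j ∈ Finset.range m, |c j| with hS
  have hS0 : 0 ≤ S := Finset.sum_nonneg fun j _ => abs_nonneg _
  filter_upwards [eventually_ge_atTop 0, hprod.eventually_gt_atTop ((|K| + S) ^ m)] with t ht hlt
  have hle : ∏ j ∈ Finset.range m, x j t ≤ (x 0 t + S) ^ m := by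
    have := Finset.prod_le_prod (s := Finset.range m) (f := fun j => x j t)
      (g := fun _ => x 0 t + S) (fun j _ => h0 j t) fun j hj => by
        rw [hc j (Finset.mem_range.1 hj) t ht]
        have : |c j| ≤ S := Finset.single_le_sum (f := fun j => |c j|) (fun i _ => abs_nonneg _) hj
        linarith [le_abs_self (c j)]
    simpa using this
  have := lt_of_pow_lt_pow_left₀ m (add_nonneg (h0 0 t) hS0) (hlt.trans_le hle)
  linarith [le_abs_self K]

variable {n k : ℕ} {dims : ℕ → ℕ} {hout : dims (n + 1) = 1} {D : Fin k → TrainingExample (dims 0)}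
  {W : ℝ → Weights (n + 1) dims} {u : EuclideanSpace ℝ (Fin (dims 0))} {γ : ℝ}

/-- Projection off u acts on the right, so it passes through the later layers to the first one. -/
lemma norm_predictor_perp_le (hout : dims (n + 1) = 1) (W : Weights (n + 1) dims)
    (u : EuclideanSpace ℝ (Fin (dims 0))) :
    ‖predictor hout W - inner ℝ (predictor hout W) u • u‖
      ≤ (∏ j ∈ Finset.range n, ‖layerSeq W (j + 1)‖) * ‖perpRows (layerSeq W 0) u‖ := by
  have h : predictor hout W - inner ℝ (predictor hout W) u • u
      = WithLp.toLp 2 ((tailChain (layerSeq W) n * perpRows (layerSeq W 0) u)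
        (Fin.cast hout.symm 0)) := by
    ext b
    simp only [PiLp.sub_apply, PiLp.smul_apply, smul_eq_mul, PiLp.inner_apply, predictor_apply,
      Matrix.mul_apply, perpRows, Matrix.of_apply, RCLike.inner_apply, conj_trivial]
    change _ = ∑ a, tailRow hout W a * _
    simp only [mul_sub, Finset.sum_sub_distrib]
    congr 1
    simp only [Finset.mul_sum, Finset.sum_mul]
    rw [Finset.sum_comm]
    exact Finset.sum_congr rfl fun a _ => Finset.sum_congr rfl fun c _ => by ring
  rw [h, ← frobenius_norm_eq_norm_row hout]
  exact norm_tailChain_mul_le _ _ _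

lemma antitoneOn_risk (hflow : IsGradientFlow (empiricalRisk expLoss hout D) W) :
    AntitoneOn (fun t => empiricalRisk expLoss hout D (W t)) (Set.Ici 0) :=
  HasDerivWithinAt.antitoneOn_Ici (fun _ ht => hasDerivWithinAt_risk hflow ht)
    fun _ _ => neg_nonpos.2 (sq_nonneg _)

/-- Needed because the risk may start at exactly 1, its value at the zero predictor. -/
lemma exists_risk_lt (hflow : IsGradientFlow (empiricalRisk expLoss hout D) W)
    (hgrad : gradient (empiricalRisk expLoss hout D) (W 0) ≠ 0) :
    ∃ t, 0 < t ∧ empiricalRisk expLoss hout D (W t) < empiricalRisk expLoss hout D (W 0) := by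
  have h := (hasDerivWithinAt_risk hflow le_rfl).mono (Set.Ioi_subset_Ici_self (a := (0 : ℝ)))
  rw [hasDerivWithinAt_iff_tendsto_slope' (by simp)] at h
  have hneg : -‖gradient (empiricalRisk expLoss hout D) (W 0)‖ ^ 2 < 0 :=
    neg_neg_of_pos (pow_pos (norm_pos_iff.2 hgrad) 2)
  obtain ⟨t, hlt, ht⟩ := ((h.eventually_lt_const hneg).and self_mem_nhdsWithin).exists
  have ht0 : (0 : ℝ) < t := ht
  refine ⟨t, ht0, ?_⟩
  rw [slope_def_field, sub_zero, div_neg_iff] at hlt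
  rcases hlt with h | h <;> linarith [h.1, h.2]

lemma norm_sq_first_layer_le (hflow : IsGradientFlow (empiricalRisk expLoss hout D) W) {t : ℝ}
    (ht : 0 ≤ t) : ‖layerSeq (W t) 0‖ ^ 2 ≤ ‖layerSeq (W 0) 0‖ ^ 2 + 2 * t := by
  have hanti : AntitoneOn (fun t => ‖layerSeq (W t) 0‖ ^ 2 - 2 * t) (Set.Ici 0) := by
    refine HasDerivWithinAt.antitoneOn_Ici (f' := fun t => 2 * inner ℝ (predictor hout (W t))
        (linearForce (fun i => dataVector (n + 1) (D i)) (predictor hout (W t))) - 2 * 1)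
      (fun t ht => (hasDerivWithinAt_norm_sq_first_layer hflow ht).sub
        ((hasDerivAt_id t).const_mul 2).hasDerivWithinAt) fun t _ => ?_
    linarith [inner_self_linearForce_le (V := fun i => dataVector (n + 1) (D i))
      (predictor hout (W t))]
  have := hanti (Set.mem_Ici.2 le_rfl) (Set.mem_Ici.2 ht) ht
  simp only at this
  linarith

/-- The risk tends to zero along gradient flow. -/
lemma tendsto_risk_zero (hk : 1 ≤ k) (hγ : 0 < γ) (hnorm : ‖u‖ = 1)
    (hu : ∀ i, γ ≤ inner ℝ u (dataVector (n + 1) (D i)))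
    (hflow : IsGradientFlow (empiricalRisk expLoss hout D) W)
    (hgrad : gradient (empiricalRisk expLoss hout D) (W 0) ≠ 0)
    (hrisk : empiricalRisk expLoss hout D (W 0) ≤ expLoss 0) :
    Tendsto (fun t => empiricalRisk expLoss hout D (W t)) atTop (𝓝 0) := by
  obtain ⟨a, ha, hlt⟩ := exists_risk_lt hflow hgrad
  set V := fun i => dataVector (n + 1) (D i) with hV
  set R := fun t => empiricalRisk expLoss hout D (W t) with hR
  have hRV : ∀ t, R t = linearRisk V (predictor hout (W t)) := fun t => empiricalRisk_eq hout D _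
  set δ := 1 - R a with hδ
  have hδ0 : 0 < δ := by
    have : expLoss 0 = 1 := by simp [expLoss]
    have : R a < R 0 := hlt
    have : R 0 ≤ expLoss 0 := hrisk
    linarith
  set S := ∑ i, ‖V i‖ with hS
  have hS0 : 0 ≤ S := Finset.sum_nonneg fun i _ => norm_nonneg _
  have hlow : ∀ t, 1 - ‖predictor hout (W t)‖ * S ≤ R t := fun t => by
    rw [hRV]; exact one_sub_le_linearRisk hk _
  set C := ‖layerSeq (W 0) 0‖ ^ 2 + 1 with hC
  have hC0 : 0 < C := by positivity
  clear_value δ S C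
  have hκ0 : 0 < (δ * γ / (S + 1)) ^ 2 := by positivity
  have hRpos : ∀ t, 0 < R t := fun t => by rw [hRV]; exact linearRisk_pos hk _
  suffices hdecay : ∀ t, a ≤ t → (δ * γ / (S + 1)) ^ 2 * R t ^ 2 / (C + 2 * t)
      ≤ ‖gradient (empiricalRisk expLoss hout D) (W t)‖ ^ 2 from
    tendsto_zero_of_deriv_le ha.le hC0 hκ0 (fun t _ => hRpos t)
      (fun t ht => (hasDerivWithinAt_risk hflow (ha.le.trans ht)).mono
        (Set.Ici_subset_Ici.2 ha.le)) fun t ht => neg_le_neg (hdecay t ht)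
  intro t ht
  have ht0 : 0 ≤ t := ha.le.trans ht
  refine le_trans ?_ (norm_tailRow_mul_norm_linearForce_le hout D (W t))
  set p := ‖tailRow hout (W t)‖
  set q := ‖linearForce V (predictor hout (W t))‖
  set w := ‖predictor hout (W t)‖
  set x := ‖layerSeq (W t) 0‖
  have hRt := hRpos t
  have hp0 : 0 ≤ p := norm_nonneg _
  have hx0 : 0 ≤ x := norm_nonneg _
  have hq : γ * R t ≤ q := by
    rw [hRV]
    refine (margin_mul_linearRisk_le hu _).trans ((real_inner_le_norm _ _).trans_eq ?_)
    rw [hnorm, one_mul]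
  -- Monotonicity gives 1 - wS ≤ R t ≤ R a = 1 - δ; S + 1 replaces S to allow division.
  have hw : δ ≤ w * (S + 1) := by
    have h1 : 1 - w * S ≤ R t := hlow t
    have h2 : R t ≤ R a := antitoneOn_risk hflow (Set.mem_Ici.2 ha.le) (Set.mem_Ici.2 ht0) ht
    have h3 : 0 ≤ w := norm_nonneg _
    linarith
  have hδp : δ / (S + 1) ≤ p * x :=
    ((div_le_iff₀ (by positivity)).2 hw).trans (norm_predictor_le hout (W t))
  have hx : x ^ 2 ≤ C + 2 * t := by
    have := norm_sq_first_layer_le hflow ht0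
    linarith
  have hmul : δ / (S + 1) * (γ * R t) ≤ p * x * q :=
    mul_le_mul hδp hq (by positivity) (by positivity)
  rw [div_le_iff₀ (by positivity)]
  calc (δ * γ / (S + 1)) ^ 2 * R t ^ 2 = (δ / (S + 1) * (γ * R t)) ^ 2 := by ring
    _ ≤ (p * x * q) ^ 2 := pow_le_pow_left₀ (by positivity) hmul 2
    _ = p ^ 2 * q ^ 2 * x ^ 2 := by ring
    _ ≤ p ^ 2 * q ^ 2 * (C + 2 * t) := by gcongr

lemma tendsto_inner_predictor_atTop (hk : 1 ≤ k) (hγ : 0 < γ) (hnorm : ‖u‖ = 1)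
    (hu : ∀ i, γ ≤ inner ℝ u (dataVector (n + 1) (D i)))
    (hmax : ∀ x : EuclideanSpace ℝ (Fin (dims 0)), ‖x‖ = 1 →
      ∃ i, inner ℝ x (dataVector (n + 1) (D i)) ≤ γ)
    (hR : Tendsto (fun t => empiricalRisk expLoss hout D (W t)) atTop (𝓝 0)) :
    Tendsto (fun t => inner ℝ (predictor hout (W t)) u) atTop atTop := by
  have hexp : Tendsto (fun t => Real.exp (-(γ * inner ℝ (predictor hout (W t)) u))) atTop
      (𝓝 0) := by
    refine squeeze_zero (fun t => (Real.exp_pos _).le) (fun t => ?_)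
      (by simpa using hR.const_mul (k : ℝ))
    rw [empiricalRisk_eq]
    exact exp_neg_margin_le_linearRisk hk hγ hnorm hu hmax _
  rw [Real.tendsto_exp_comp_nhds_zero, tendsto_neg_atBot_iff] at hexp
  exact (tendsto_const_mul_atTop_of_pos hγ).1 hexp

lemma prod_norm_ge (hout : dims (n + 1) = 1) (W : Weights (n + 1) dims) :
    ‖predictor hout W‖ ≤ ∏ j ∈ Finset.range (n + 1), ‖layerSeq W j‖ := by
  rw [norm_predictor]
  exact norm_chain_succ_le _ _

/-- The trace of the conserved balance, telescoped down to the first layer. -/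
lemma norm_sq_layer_eq (hflow : IsGradientFlow (empiricalRisk expLoss hout D) W) {j : ℕ}
    (hj : j < n + 1) {t : ℝ} (ht : 0 ≤ t) :
    ‖layerSeq (W t) j‖ ^ 2 = ‖layerSeq (W t) 0‖ ^ 2
      + (‖layerSeq (W 0) j‖ ^ 2 - ‖layerSeq (W 0) 0‖ ^ 2) := by
  induction j with
  | zero => ring
  | succ j ih =>
    have h := congrArg Matrix.trace (balance_eq hflow (j := j) (by omega) ht)
    simp only [Matrix.trace_sub, trace_transpose_mul_self, trace_mul_transpose_self] at h
    linarith [ih (by omega)]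

lemma tendsto_norm_sq_layer_atTop (hflow : IsGradientFlow (empiricalRisk expLoss hout D) W)
    (hw : Tendsto (fun t => ‖predictor hout (W t)‖) atTop atTop) {j : ℕ} (hj : j < n + 1) :
    Tendsto (fun t => ‖layerSeq (W t) j‖ ^ 2) atTop atTop := by
  have h0 : Tendsto (fun t => ‖layerSeq (W t) 0‖ ^ 2) atTop atTop := by
    refine tendsto_atTop_of_prod (x := fun j t => ‖layerSeq (W t) j‖ ^ 2) (m := n + 1)
      (fun j t => sq_nonneg _) (fun j hj t ht => norm_sq_layer_eq hflow hj ht) ?_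
    simp only [Finset.prod_pow]
    exact (tendsto_pow_atTop two_ne_zero).comp
      (tendsto_atTop_mono (fun t => prod_norm_ge hout (W t)) hw)
  refine (tendsto_atTop_add_const_right _
    (‖layerSeq (W 0) j‖ ^ 2 - ‖layerSeq (W 0) 0‖ ^ 2) h0).congr' ?_
  filter_upwards [eventually_ge_atTop 0] with t ht
  exact (norm_sq_layer_eq hflow hj ht).symm

/-- The norm of the product of the layers is asymptotic to the product of their norms. -/
lemma tendsto_norm_predictor_div (hflow : IsGradientFlow (empiricalRisk expLoss hout D) W)
    (hw : Tendsto (fun t => ‖predictor hout (W t)‖) atTop atTop) :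
    Tendsto (fun t => (∏ j ∈ Finset.range (n + 1), ‖layerSeq (W t) j‖)⁻¹
      * ‖predictor hout (W t)‖) atTop (𝓝 1) := by
  have hlay := fun j hj => tendsto_norm_sq_layer_atTop hflow hw (j := j) hj
  have hne : ∀ j < n + 1, ∀ᶠ t in atTop, layerSeq (W t) j ≠ 0 := fun j hj => by
    filter_upwards [(hlay j hj).eventually_gt_atTop 0] with t ht h
    simp [h] at ht
  set N : ℝ → LayerSeq dims := fun t j => ‖layerSeq (W t) j‖⁻¹ • layerSeq (W t) j with hN
  have hal : ∀ j < n, Tendsto (fun t => ‖Matrix.transpose (N t (j + 1)) * N t (j + 1)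
      - N t j * Matrix.transpose (N t j)‖) atTop (𝓝 0) := by
    intro j hj
    set C := Matrix.transpose (layerSeq (W 0) (j + 1)) * layerSeq (W 0) (j + 1)
        - layerSeq (W 0) j * Matrix.transpose (layerSeq (W 0) j)
    have hlim := ((tendsto_inv_atTop_zero.comp (hlay (j + 1) (by omega))).const_mul
      (‖C‖ + |C.trace|))
    rw [mul_zero] at hlim
    refine squeeze_zero' (.of_forall fun t => norm_nonneg _) ?_ hlim
    filter_upwards [eventually_ge_atTop 0, hne j (by omega), hne (j + 1) (by omega)]
      with t ht hB hA
    exact norm_normalized_balance_le hA hB (balance_eq hflow hj ht)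
  have hlim := tendsto_chain_mul_transpose_sub_pow (N := N)
    (fun t j => norm_normalized_le_one _) hal n le_rfl
  have hsq : Tendsto (fun t => ((∏ j ∈ Finset.range (n + 1), ‖layerSeq (W t) j‖)⁻¹
      * ‖predictor hout (W t)‖) ^ 2) atTop (𝓝 1) := by
    rw [tendsto_iff_norm_sub_tendsto_zero]
    refine hlim.congr' ?_
    filter_upwards [hne n n.lt_succ_self] with t ht
    -- Output width one makes AAᵀ a 1 × 1 matrix, so the matrix limit becomes a limit of squared
    -- norms.
    have hentry : ∀ {l : ℕ} (A : Matrix (Fin (dims (n + 1))) (Fin l) ℝ),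
        (A * Matrix.transpose A) = ‖A‖ ^ 2 • (1 : Matrix (Fin (dims (n + 1))) _ ℝ) := by
      intro l A
      have : Subsingleton (Fin (dims (n + 1))) := by rw [hout]; infer_instance
      ext a b
      rw [← trace_mul_transpose_self, Subsingleton.elim b a, Matrix.trace,
        Finset.sum_eq_single a (fun c _ hc => absurd (Subsingleton.elim c a) hc) (by simp)]
      simp
    have hone : ‖N t n‖ = 1 := by
      rw [hN, norm_smul, norm_inv, norm_norm, inv_mul_cancel₀ (norm_ne_zero_iff.2 ht)]
    have hchain : ‖chain (N t) (n + 1)‖ = (∏ j ∈ Finset.range (n + 1), ‖layerSeq (W t) j‖)⁻¹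
        * ‖predictor hout (W t)‖ := by
      rw [hN, chain_normalized, norm_smul, norm_predictor, norm_inv,
        Real.norm_of_nonneg (Finset.prod_nonneg fun j _ => norm_nonneg _)]
    rw [hentry, hentry, hone, hchain, one_pow, one_smul, one_pow]
    set y := ((∏ j ∈ Finset.range (n + 1), ‖layerSeq (W t) j‖)⁻¹ * ‖predictor hout (W t)‖) ^ 2
    have hy : y • (1 : Matrix (Fin (dims (n + 1))) (Fin (dims (n + 1))) ℝ) - 1 = (y - 1) • 1 := by
      rw [sub_smul, one_smul]
    rw [hy, norm_smul]
    have : ‖(1 : Matrix (Fin (dims (n + 1))) (Fin (dims (n + 1))) ℝ)‖ = 1 := by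
      rw [frobenius_norm_eq_norm_row hout, ← sq_eq_sq₀ (norm_nonneg _) zero_le_one,
        EuclideanSpace.norm_sq_eq]
      simp [Matrix.one_apply]
    rw [this, mul_one]
  have := hsq.sqrt
  simp only [Real.sqrt_one] at this
  refine this.congr fun t => Real.sqrt_sq ?_
  exact mul_nonneg (inv_nonneg.2 (Finset.prod_nonneg fun j _ => norm_nonneg _)) (norm_nonneg _)

/-- The component of the first layer orthogonal to the maximum-margin direction is negligible. -/
lemma tendsto_norm_perpRows_div (hk : 1 ≤ k) (hγ : 0 < γ) (hnorm : ‖u‖ = 1)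
    (hu : ∀ i, γ ≤ inner ℝ u (dataVector (n + 1) (D i)))
    (hmax : ∀ x : EuclideanSpace ℝ (Fin (dims 0)), ‖x‖ = 1 →
      ∃ i, inner ℝ x (dataVector (n + 1) (D i)) ≤ γ)
    (hflow : IsGradientFlow (empiricalRisk expLoss hout D) W)
    (hs : Tendsto (fun t => inner ℝ (predictor hout (W t)) u) atTop atTop)
    (hx : Tendsto (fun t => ‖layerSeq (W t) 0‖ ^ 2) atTop atTop) :
    Tendsto (fun t => ‖perpRows (layerSeq (W t) 0) u‖ / ‖layerSeq (W t) 0‖) atTop (𝓝 0) := by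
  set V := fun i => dataVector (n + 1) (D i) with hV
  set A := fun t => ∑ a, (∑ b, layerSeq (W t) 0 a b * u b) ^ 2 with hA
  set B := fun t => ‖perpRows (layerSeq (W t) 0) u‖ ^ 2 with hB
  have hAB : ∀ t, A t + B t = ‖layerSeq (W t) 0‖ ^ 2 := fun t =>
    sum_sq_add_norm_perpRows_sq _ hnorm
  set w := fun t => predictor hout (W t) with hw
  set s := fun t => inner ℝ (w t) u with hs'
  set q := fun t => linearForce V (w t) with hq
  have hlim : Tendsto (fun t => B t / (A t + B t)) atTop (𝓝 0) := by
    refine tendsto_div_add_zero (a := 0) (A' := fun t => 2 * s t * inner ℝ u (q t))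
      (B' := fun t => 2 * inner ℝ (w t) (q t) - 2 * s t * inner ℝ u (q t))
      (fun t ht => hasDerivWithinAt_norm_sq_first_layer_mulVec hflow u ht) (fun t ht => ?_)
      (fun t => sq_nonneg _) (fun ε hε => ?_) (by simpa only [hAB] using hx)
    · have hBeq : B = fun t => ‖layerSeq (W t) 0‖ ^ 2 - A t :=
        funext fun t => by linarith [hAB t]
      rw [hBeq]
      exact (hasDerivWithinAt_norm_sq_first_layer hflow ht).sub
        (hasDerivWithinAt_norm_sq_first_layer_mulVec hflow u ht)
    -- Beyond s = k/(εγ), half of B' is at most kR ≤ εsγR ≤ εs⟪u, q⟫, which is ε times half of A'.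
    · filter_upwards [hs.eventually_ge_atTop 0, hs.eventually_ge_atTop (k / (ε * γ))] with t h0 h1
      have h0 : 0 ≤ s t := h0
      rw [div_le_iff₀ (by positivity)] at h1
      have hR := linearRisk_pos (V := V) hk (w t)
      have h2 : inner ℝ (w t) (q t) - s t * inner ℝ u (q t) ≤ k * linearRisk V (w t) := by
        have h3 := (inner_perp_linearForce_le hu h0).trans
          (exp_neg_margin_le_linearRisk hk hγ hnorm hu hmax (w t))
        rwa [inner_sub_left, inner_smul_left] at h3
      have h4 := margin_mul_linearRisk_le hu (w t)
      have h5 : k * linearRisk V (w t) ≤ s t * (ε * γ) * linearRisk V (w t) :=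
        mul_le_mul_of_nonneg_right h1 hR.le
      have h6 : s t * ε * (γ * linearRisk V (w t)) ≤ s t * ε * inner ℝ u (q t) :=
        mul_le_mul_of_nonneg_left h4 (by positivity)
      linarith
  have := hlim.sqrt
  rw [Real.sqrt_zero] at this
  refine this.congr fun t => ?_
  rw [hAB, Real.sqrt_div (sq_nonneg _), Real.sqrt_sq (norm_nonneg _), Real.sqrt_sq (norm_nonneg _)]

/-- A family of vectors whose norms tend to one and whose components orthogonal to the unit vector
`u` vanish in the limit tends to `u`, if it lies on the same side as `u`. -/
lemma tendsto_of_norm_of_perp {E ι : Type*} [NormedAddCommGroup E] [InnerProductSpace ℝ E]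
    {l : Filter ι} {x : ι → E} {u : E} (hu : ‖u‖ = 1) (hx : Tendsto (fun t => ‖x t‖) l (𝓝 1))
    (hperp : Tendsto (fun t => ‖x t - inner ℝ (x t) u • u‖) l (𝓝 0))
    (hpos : ∀ᶠ t in l, 0 ≤ inner ℝ (x t) u) : Tendsto x l (𝓝 u) := by
  have hpyth : ∀ t, inner ℝ (x t) u ^ 2 = ‖x t‖ ^ 2 - ‖x t - inner ℝ (x t) u • u‖ ^ 2 := by
    intro t
    rw [norm_sub_sq_real, norm_smul, hu, inner_smul_right, mul_one, Real.norm_eq_abs, sq_abs]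
    ring
  have hc : Tendsto (fun t => inner ℝ (x t) u) l (𝓝 1) := by
    have h := ((hx.pow 2).sub (hperp.pow 2)).sqrt
    norm_num at h
    refine h.congr' ?_
    filter_upwards [hpos] with t ht
    rw [← hpyth, Real.sqrt_sq ht]
  have := (tendsto_zero_iff_norm_tendsto_zero.2 hperp).add (hc.smul_const u)
  simpa using this

end Convergence

/-! ### Assembly: from the predictor to the matrix product. -/

theorem mainTheorem4 (L : ℕ) (hL : 1 ≤ L) (dims : ℕ → ℕ) (hout : dims L = 1)
    (k : ℕ) (hk : 1 ≤ k) (D : Fin k → TrainingExample (dims 0))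
    (hsep : ∃ u : EuclideanSpace ℝ (Fin (dims 0)), ∀ i, 0 < inner ℝ u (dataVector L (D i)))
    (ubar : EuclideanSpace ℝ (Fin (dims 0))) (hubar : IsMaxMarginDirection L D ubar)
    (hspan : Submodule.span ℝ (supportVectors L D ubar) = ⊤)
    (W : ℝ → Weights L dims)
    (hflow : IsGradientFlow (empiricalRisk expLoss hout D) W)
    (hinit_grad : gradient (empiricalRisk expLoss hout D) (W 0) ≠ 0)
    (hinit_risk : empiricalRisk expLoss hout D (W 0) ≤ expLoss 0) :
    Tendsto (fun t : ℝ => (∏ j, frobeniusNorm (layer (W t) j))⁻¹ • weightProd (W t)) atTop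
      (𝓝 (Matrix.replicateRow (Fin (dims L)) ubar)) := by
  obtain ⟨n, rfl⟩ : ∃ n, L = n + 1 := ⟨L - 1, by omega⟩
  have hγ := hubar.margin_pos hk hsep
  have hnorm : ‖ubar‖ = 1 := by simpa using hubar.1
  have hu : ∀ i, margin (n + 1) D ubar ≤ inner ℝ ubar (dataVector (n + 1) (D i)) :=
    fun i => margin_le_inner i ubar
  have hmax := hubar.exists_inner_le hk
  have hR := tendsto_risk_zero hk hγ hnorm hu hflow hinit_grad hinit_risk
  have hs := tendsto_inner_predictor_atTop hk hγ hnorm hu hmax hR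
  have hw : Tendsto (fun t => ‖predictor hout (W t)‖) atTop atTop :=
    tendsto_atTop_mono (fun t => by simpa [hnorm] using real_inner_le_norm (predictor hout (W t)) ubar) hs
  have hlay := tendsto_norm_sq_layer_atTop hflow hw n.succ_pos
  set P := fun t => ∏ j ∈ Finset.range (n + 1), frobeniusNorm (layerSeq (W t) j) with hP
  have hP0 : ∀ t, 0 ≤ P t := fun t => (norm_nonneg _).trans (prod_norm_ge hout (W t))
  have hdir : Tendsto (fun t => (P t)⁻¹ • predictor hout (W t)) atTop (𝓝 ubar) := by
    refine tendsto_of_norm_of_perp hnorm ?_ ?_ ?_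
    · refine (tendsto_norm_predictor_div hflow hw).congr fun t => ?_
      rw [norm_smul, norm_inv, Real.norm_of_nonneg (hP0 t)]
      rfl
    · refine squeeze_zero' (.of_forall fun t => norm_nonneg _) ?_
        (tendsto_norm_perpRows_div hk hγ hnorm hu hmax hflow hs hlay)
      filter_upwards [hw.eventually_gt_atTop 0] with t ht
      have hPpos : 0 < P t := ht.trans_le (prod_norm_ge hout (W t))
      -- Splitting off the first layer's norm leaves exactly the factor of `norm_predictor_perp_le`,
      -- hence the ratio of `tendsto_norm_perpRows_div`.
      have hPeq : P t = (∏ j ∈ Finset.range n, frobeniusNorm (layerSeq (W t) (j + 1)))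
          * frobeniusNorm (layerSeq (W t) 0) := Finset.prod_range_succ' _ _
      have hne := hPpos.ne'
      rw [hPeq] at hne
      rw [inner_smul_left, conj_trivial, mul_smul, ← smul_sub, norm_smul, norm_inv,
        Real.norm_of_nonneg (hP0 t), inv_mul_le_iff₀ hPpos]
      refine (norm_predictor_perp_le hout (W t) ubar).trans_eq ?_
      rw [hPeq]
      have h0 := right_ne_zero_of_mul hne
      change _ = _ * (_ / frobeniusNorm (layerSeq (W t) 0))
      rw [mul_assoc, mul_div_cancel₀ _ h0]
      rfl
    · filter_upwards [hs.eventually_ge_atTop 0] with t ht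
      rw [inner_smul_left]
      exact mul_nonneg (by simpa using hP0 t) ht
  refine tendsto_pi_nhds.2 fun a => tendsto_pi_nhds.2 fun b => ?_
  have hb := ((EuclideanSpace.proj (𝕜 := ℝ) b).continuous.tendsto ubar).comp hdir
  refine hb.congr fun t => ?_
  have ha : a = Fin.cast hout.symm 0 := by
    apply Fin.ext
    have := a.2
    simp only [Fin.val_cast, Fin.val_zero]
    omega
  have hprod : ∏ j, frobeniusNorm (layer (W t) j) = P t := by
    refine Eq.trans ?_ (Finset.prod_range _).symm
    exact Finset.prod_congr rfl fun j _ => by rw [layerSeq_of_lt _ j.2]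
  rw [hprod, weightProd, partialProd_eq_chain, ha]
  rfl
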